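/- Let $K$ be a number field with ring of integers $\mathcal{O}_K$, put $\widehat K=K\otimes_{\mathbb Q}\mathbb R$, and let $\mathfrak n$ be a nonzero ideal of $\mathcal{O}_K$. A \emph{lattice} is a finitely generated $\mathcal{O}_K$-submodule $L\subset\widehat K^2$ with $\widehat K L=\widehat K^2$ and $\dim_K KL=2$ (equivalently, $\widehat K L=\widehat K^2$ and $L$ lies between two free $\mathcal{O}_K$-submodules of rank $2$). For lattices $L\subseteq M$ with $M/L\cong\mathcal{O}_K/\mathfrak a_1\oplus\mathcal{O}_K/\mathfrak a_2$ and $\mathfrak a_1\mid\mathfrak a_2$, write $[M:L]=\mathfrak a_1\mathfrak a_2$. Let $\mathcal M_0(\mathfrak n)$ be the set of modular points for $\Gamma_0(\mathfrak n)$, that is, of pairs $(L,L')$ of lattices with $L\subseteq L'$ and $L'/L\cong\mathcal{O}_K/\mathfrak n$, and let $\mathbb Q\mathcal M_0(\mathfrak n)$ be the $\mathbb Q$-vector space with basis $\mathcal M_0(\mathfrak n)$. Write $N(\mathfrak a)=\#(\mathcal{O}_K/\mathfrak a)$. For a nonzero ideal $\mathfrak a$ of $\mathcal{O}_K$, the Hecke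 operator $T_{\mathfrak a}$ is the linear operator on $\mathbb Q\mathcal M_0(\mathfrak n)$ with \[ T_{\mathfrak a}(L,L')=N(\mathfrak a)^{-1}\sum_{M}(M,M+L'), \] where $M$ runs over the finitely many lattices $M\supseteq L$ with $[M:L]=\mathfrak a$ such that $(M,M+L')\in\mathcal M_0(\mathfrak n)$. For an exact divisor $\mathfrak q\,\|\,\mathfrak n$, that is, $\mathfrak n=\mathfrak q\mathfrak q'$ with ideals $\mathfrak q,\mathfrak q'$ coprime, the Atkin--Lehner operator $W_{\mathfrak q}$ is the linear operator on $\mathbb Q\mathcal M_0(\mathfrak n)$ with \[ W_{\mathfrak q}(L,L')=N(\mathfrak q)^{-1}\,(L+\mathfrak q'L',\ \mathfrak q^{-1}L+L'). \] \textbf{Proposition.} For every nonzero ideal $\mathfrak a$ of $\mathcal{O}_K$ coprime to $\mathfrak n$ and every exact divisor $\mathfrak q\,\|\,\mathfrak n$, the operators $T_{\mathfrak a}$ and $W_{\mathfrak q}$ on $\mathbb Q\mathcal M_0(\mathfrak n)$ commute: $T_{\mathfrak a}W_{\mathfrak q}=W_{\mathfrak q}T_{\mathfrak a}$. -/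

import Mathlib

open scoped NumberField nonZeroDivisors TensorProduct

noncomputable section
namespace HeckeAL
/-- The real algebra `K ⊗ ℝ`, that is, the product of the archimedean completions of `K`. -/
abbrev KHat (K : Type*) [Field K] [NumberField K] : Type _ := K ⊗[ℚ] ℝ
/-- Row vectors of length two over `K ⊗ ℝ`; `K` and `𝓞 K` act through the diagonal embedding
`K → K ⊗ ℝ`. -/
abbrev RowSpace (K : Type*) [Field K] [NumberField K] : Type _ := Fin 2 → KHat K
/-! ### Auxiliary module theory

These facts are used only to see that the Hecke sums are finite and that the Atkin–Lehner map
sends modular points to modular points. -/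

theorem cyc_of_equiv {R E : Type*} [CommRing R] [AddCommGroup E] [Module R E]
    {A B : Submodule R E} {n : Ideal R} (e : (B ⧸ A.submoduleOf B) ≃ₗ[R] R ⧸ n) :
    ∃ β ∈ B, B ≤ A ⊔ Submodule.span R {β} ∧ ∀ r : R, r • β ∈ A ↔ r ∈ n := by
  obtain ⟨β, hβ⟩ := Submodule.Quotient.mk_surjective _ (e.symm 1)
  have key (r : R) (x : B) : x - r • β ∈ A.submoduleOf B ↔ e (Submodule.Quotient.mk x) = Ideal.Quotient.mk n r := by
    rw [← Submodule.Quotient.eq, Submodule.Quotient.mk_smul, hβ, ← map_smul, LinearEquiv.eq_symm_apply]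
    have : r • (1 : R ⧸ n) = Ideal.Quotient.mk n r := by
      rw [Algebra.smul_def, mul_one]; rfl
    rw [this]
  refine ⟨β, β.2, fun x hx => ?_, fun r => ?_⟩
  · obtain ⟨r, hr⟩ := Ideal.Quotient.mk_surjective (e (Submodule.Quotient.mk ⟨x, hx⟩))
    have := (key r ⟨x, hx⟩).2 hr.symm
    have h2 : x - r • (β : E) ∈ A := this
    rw [← sub_add_cancel x (r • (β : E))]
    exact Submodule.add_mem_sup h2 (Submodule.smul_mem _ _ (Submodule.mem_span_singleton_self _))
  · have := key r 0
    rw [zero_sub, neg_mem_iff, Submodule.Quotient.mk_zero, map_zero, eq_comm, Ideal.Quotient.eq_zero_iff_mem] at this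
    exact this

theorem equiv_of_cyc {R E : Type*} [CommRing R] [AddCommGroup E] [Module R E]
    {A B : Submodule R E} {n : Ideal R} {β : E} (hβ : β ∈ B)
    (hB : B ≤ A ⊔ Submodule.span R {β}) (hn : ∀ r : R, r • β ∈ A ↔ r ∈ n) :
    Nonempty ((B ⧸ A.submoduleOf B) ≃ₗ[R] R ⧸ n) := by
  let f : R →ₗ[R] (B ⧸ A.submoduleOf B) :=
    (A.submoduleOf B).mkQ ∘ₗ LinearMap.toSpanSingleton R B ⟨β, hβ⟩
  have hf : Function.Surjective f := by
    intro y
    obtain ⟨x, rfl⟩ := Submodule.Quotient.mk_surjective _ y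
    obtain ⟨a, ha, b, hb, hab⟩ := Submodule.mem_sup.1 (hB x.2)
    obtain ⟨r, rfl⟩ := Submodule.mem_span_singleton.1 hb
    refine ⟨r, (Submodule.Quotient.eq _).2 ?_⟩
    change r • β - (x : E) ∈ A
    rw [← hab]; simpa using ha
  have hk : LinearMap.ker f = n := by
    ext r
    rw [LinearMap.mem_ker, ← hn]
    exact (Submodule.Quotient.mk_eq_zero _)
  exact ⟨((Submodule.quotEquivOfEq _ _ hk).symm.trans (f.quotKerEquivOfSurjective hf)).symm⟩

open Module in
theorem exists_coords {R N : Type*} [CommRing R] [IsDedekindDomain R] [AddCommGroup N] [Module R N]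
    [Module.Finite R N] [Module.IsTorsionFree R N] (hN : finrank R N = 2) (q : Ideal R)
    [Finite (R ⧸ q)] :
    ∃ φ : N →ₗ[R] (Fin 2 → R ⧸ q), Function.Surjective φ ∧
      LinearMap.ker φ = q • (⊤ : Submodule R N) := by
  have : Finite (MaximalSpectrum (R ⧸ q)) := 
    Finite.of_injective _ MaximalSpectrum.toPrimeSpectrum_injective
  have rk (P : MaximalSpectrum (R ⧸ q)) :
      finrank ((R ⧸ q) ⧸ P.1) (((R ⧸ q) ⧸ P.1) ⊗[R ⧸ q] ((R ⧸ q) ⊗[R] N)) = 2 := by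
    have := P.2
    let := Ideal.Quotient.field P.1
    let p0 : PrimeSpectrum ((R ⧸ q) ⧸ P.1) := ⊥
    have h1 := congrFun (rankAtStalk_eq_finrank_of_free (R := (R ⧸ q) ⧸ P.1)
      (M := ((R ⧸ q) ⧸ P.1) ⊗[R ⧸ q] ((R ⧸ q) ⊗[R] N))) p0
    rw [rankAtStalk_baseChange, rankAtStalk_baseChange] at h1
    rw [Pi.natCast_apply, Nat.cast_id] at h1
    rw [← h1, ← hN]
    exact (Ideal.finrank_fiber_eq_rankAtStalk _).symm.trans (Ideal.finrank_fiber_eq_finrank _)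
  obtain ⟨b⟩ := nonempty_basis_of_flat_of_finrank_eq (R ⧸ q) ((R ⧸ q) ⊗[R] N) 2 rk
  let e : (N ⧸ (q • ⊤ : Submodule R N)) ≃ₗ[R] (Fin 2 → R ⧸ q) :=
    (TensorProduct.quotTensorEquivQuotSMul N q).symm.trans (b.equivFun.restrictScalars R)
  refine ⟨e.toLinearMap ∘ₗ Submodule.mkQ _, e.surjective.comp (Submodule.mkQ_surjective _), ?_⟩
  rw [LinearEquiv.ker_comp, Submodule.ker_mkQ]

open Module in
theorem exists_complement {R N : Type*} [CommRing R] [IsDedekindDomain R] [AddCommGroup N]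
    [Module R N] [Module.Finite R N] [Module.IsTorsionFree R N] (hN : finrank R N = 2)
    {q : Ideal R} (hq : q ≠ ⊥) [Finite (R ⧸ q)] {v : N}
    (hv : ∀ r : R, r • v ∈ (q • ⊤ : Submodule R N) → r ∈ q) :
    ∃ g : N, (∀ x, ∃ r : R, x - r • g ∈ (q • ⊤ : Submodule R N) ⊔ Submodule.span R {v}) ∧
      ∀ r : R, r • g ∈ (q • ⊤ : Submodule R N) ⊔ Submodule.span R {v} ↔ r ∈ q := by
  obtain ⟨φ, hφ, hk⟩ := exists_coords hN q
  have hs (r : R) (x : N) (i : Fin 2) : φ (r • x) i = algebraMap R (R ⧸ q) r * φ x i := by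
    rw [map_smul, Pi.smul_apply, Algebra.smul_def]
  have huni : Ideal.span {φ v 0, φ v 1} = (⊤ : Ideal (R ⧸ q)) := by
    by_contra hJ
    obtain ⟨P, hP, hJP⟩ := Ideal.exists_le_maximal _ hJ
    let p : Ideal R := P.comap (Ideal.Quotient.mk q)
    have hqp : q ≤ p := by
      intro x hx
      change Ideal.Quotient.mk q x ∈ P
      rw [Ideal.Quotient.eq_zero_iff_mem.2 hx]; exact P.zero_mem
    have hp : p ≠ ⊤ := (Ideal.comap_isMaximal_of_surjective _ Ideal.Quotient.mk_surjective).ne_top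
    obtain ⟨q0, hq0⟩ := Ideal.dvd_iff_le.2 hqp
    have : q0 ≤ q := by
      intro r hr
      apply hv
      rw [← hk, LinearMap.mem_ker]
      ext i
      obtain ⟨c, hc⟩ := Ideal.Quotient.mk_surjective (φ v i)
      have hcP : φ v i ∈ P := by
        apply hJP
        apply Ideal.subset_span
        fin_cases i <;> simp
      have hcp : c ∈ p := by change Ideal.Quotient.mk q c ∈ P; rwa [hc]
      have : r * c ∈ q := by
        rw [hq0, mul_comm r]; exact Ideal.mul_mem_mul hcp hr
      rw [hs, ← hc, Pi.zero_apply]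
      exact (Ideal.Quotient.eq_zero_iff_mem (I := q)).2 this
    have h2 : q0 = q := le_antisymm this (by rw [hq0]; exact Ideal.mul_le_right)
    rw [h2] at hq0
    apply hp
    have : (1 : Ideal R) * q = p * q := by rw [one_mul]; exact hq0
    exact (mul_right_cancel₀ hq this).symm.trans Ideal.one_eq_top
  obtain ⟨s, t, hst⟩ := Ideal.mem_span_pair.1 (huni ▸ Submodule.mem_top : (1 : R ⧸ q) ∈ _)
  have hker (x : N) : x ∈ (q • ⊤ : Submodule R N) ⊔ Submodule.span R {v} ↔
      φ v 0 * φ x 1 - φ v 1 * φ x 0 = 0 := by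
    constructor
    · intro hx
      obtain ⟨a, ha, b, hb, rfl⟩ := Submodule.mem_sup.1 hx
      obtain ⟨r, rfl⟩ := Submodule.mem_span_singleton.1 hb
      rw [← hk, LinearMap.mem_ker] at ha
      simp only [map_add, ha, zero_add, hs]
      ring
    · intro hx
      obtain ⟨c, hc⟩ := Ideal.Quotient.mk_surjective (s * φ x 0 + t * φ x 1)
      rw [← sub_add_cancel x (c • v)]
      refine Submodule.add_mem_sup ?_ (Submodule.smul_mem _ _ (Submodule.mem_span_singleton_self _))
      rw [← hk, LinearMap.mem_ker, map_sub, map_smul, sub_eq_zero]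
      have hc' : algebraMap R (R ⧸ q) c = s * φ x 0 + t * φ x 1 := hc
      ext i
      rw [Pi.smul_apply, Algebra.smul_def, hc']
      fin_cases i
      · simp only [Fin.zero_eta]
        linear_combination (-(φ x 0)) * hst - t * hx
      · simp only [Fin.mk_one]
        linear_combination (-(φ x 1)) * hst + s * hx
  obtain ⟨g, hg⟩ := hφ ![-t, s]
  have hg0 : φ g 0 = -t := by rw [hg]; rfl
  have hg1 : φ g 1 = s := by rw [hg]; rfl
  refine ⟨g, fun x => ?_, fun r => ?_⟩
  · obtain ⟨c, hc⟩ := Ideal.Quotient.mk_surjective (φ v 0 * φ x 1 - φ v 1 * φ x 0)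
    have hc' : algebraMap R (R ⧸ q) c = _ := hc
    refine ⟨c, (hker _).2 ?_⟩
    simp only [map_sub, Pi.sub_apply, hs, hc', hg0, hg1]
    linear_combination (- (φ v 0 * φ x 1 - φ v 1 * φ x 0)) * hst
  · rw [hker]
    simp only [hs, hg0, hg1]
    rw [← Ideal.Quotient.eq_zero_iff_mem]
    change _ ↔ algebraMap R (R ⧸ q) r = 0
    rw [show φ v 0 * (algebraMap R (R ⧸ q) r * s) - φ v 1 * (algebraMap R (R ⧸ q) r * -t) =
      algebraMap R (R ⧸ q) r * (s * φ v 0 + t * φ v 1) by ring, hst, mul_one]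


/-- `[M : L] = a`: the quotient `M / L` is isomorphic to `R/a₁ ⊕ R/a₂` with `a₁ ∣ a₂` (the elementary
divisors) and `a = a₁ a₂`. It is used for lattices `L ≤ M`. -/
def HasIndexIdeal {R E : Type*} [CommRing R] [AddCommGroup E] [Module R E]
    (M L : Submodule R E) (a : Ideal R) : Prop :=
  ∃ a₁ a₂ : Ideal (R), a₁ ∣ a₂ ∧ a₁ * a₂ = a ∧
    Nonempty ((M ⧸ L.submoduleOf M) ≃ₗ[R] (R ⧸ a₁) × (R ⧸ a₂))

theorem HasIndexIdeal.smul_mem {R E : Type*} [CommRing R] [AddCommGroup E] [Module R E]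
    {M L : Submodule R E} {a : Ideal R}
    (h : HasIndexIdeal M L a) {r : R} (hr : r ∈ a) {x : E} (hx : x ∈ M) :
    r • x ∈ L := by
  obtain ⟨a₁, a₂, -, rfl, ⟨e⟩⟩ := h
  have key (y : (R ⧸ a₁) × (R ⧸ a₂)) : r • y = 0 := by
    obtain ⟨y, z⟩ := y
    obtain ⟨y, rfl⟩ := Ideal.Quotient.mk_surjective y
    obtain ⟨z, rfl⟩ := Ideal.Quotient.mk_surjective z
    have h₁ : Ideal.Quotient.mk a₁ r = 0 := Ideal.Quotient.eq_zero_iff_mem.2 (Ideal.mul_le_left hr)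
    have h₂ : Ideal.Quotient.mk a₂ r = 0 := Ideal.Quotient.eq_zero_iff_mem.2 (Ideal.mul_le_right hr)
    rw [Prod.smul_mk, Algebra.smul_def, Algebra.smul_def, Ideal.Quotient.algebraMap_eq,
      Ideal.Quotient.algebraMap_eq, h₁, h₂, zero_mul, zero_mul]
    rfl
  have h1 : (Submodule.Quotient.mk (r • (⟨x, hx⟩ : M)) : M ⧸ L.submoduleOf M) = 0 := by
    rw [Submodule.Quotient.mk_smul, ← e.map_eq_zero_iff, map_smul, key]
  have h2 : r • (⟨x, hx⟩ : M) ∈ L.submoduleOf M := (Submodule.Quotient.mk_eq_zero _).1 h1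
  exact h2

theorem finite_between {R E : Type*} [CommRing R] [Module.Finite ℤ R] [AddCommGroup E] [Module R E]
    {L B : Submodule R E} (hB : B.FG) {N : ℕ} (hN : N ≠ 0)
    (hNB : ∀ x ∈ B, (N : R) • x ∈ L) : {M : Submodule R E | L ≤ M ∧ M ≤ B}.Finite := by
  have : Module.Finite R B := Module.Finite.iff_fg.2 hB
  have : Module.Finite ℤ (B ⧸ L.submoduleOf B) := Module.Finite.trans R (B ⧸ L.submoduleOf B)
  have : Finite (B ⧸ L.submoduleOf B) := by
    apply Module.finite_of_fg_torsion
    intro x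
    obtain ⟨x, rfl⟩ := Submodule.Quotient.mk_surjective (L.submoduleOf B) x
    refine ⟨⟨(N : ℤ), mem_nonZeroDivisors_iff_ne_zero.2 (Nat.cast_ne_zero.2 hN)⟩, ?_⟩
    change (N : ℤ) • (Submodule.Quotient.mk x : B ⧸ L.submoduleOf B) = 0
    rw [natCast_zsmul, ← Submodule.Quotient.mk_smul, Submodule.Quotient.mk_eq_zero]
    have h := hNB x x.2
    rw [Nat.cast_smul_eq_nsmul] at h
    exact h
  have : Finite (Submodule R (B ⧸ L.submoduleOf B)) :=
    Finite.of_injective _ SetLike.coe_injective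
  have hmem {M : Submodule R E} (hM : L ≤ M) (x : B) : (x : E) ∈ M ↔
      (L.submoduleOf B).mkQ x ∈ (M.submoduleOf B).map (L.submoduleOf B).mkQ := by
    refine ⟨fun h => ⟨x, h, rfl⟩, ?_⟩
    rintro ⟨y, hy, hyx⟩
    have h1 : y - x ∈ L.submoduleOf B := (Submodule.Quotient.eq _).1 hyx
    have h2 := M.sub_mem (show (y : E) ∈ M from hy) (hM h1)
    simpa using h2
  refine Set.Finite.of_injOn (f := fun M => (M.submoduleOf B).map (L.submoduleOf B).mkQ)
    (t := Set.univ) (fun _ _ => Set.mem_univ _) ?_ Set.finite_univ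
  intro M hM M₂ hM₂ h
  have h : (M.submoduleOf B).map (L.submoduleOf B).mkQ =
    (M₂.submoduleOf B).map (L.submoduleOf B).mkQ := h
  ext x
  refine ⟨fun hx => (hmem hM₂.1 ⟨x, hM.2 hx⟩).2 ?_, fun hx => (hmem hM.1 ⟨x, hM₂.2 hx⟩).2 ?_⟩
  · exact h ▸ (hmem hM.1 ⟨x, hM.2 hx⟩).1 hx
  · exact h ▸ (hmem hM₂.1 ⟨x, hM₂.2 hx⟩).1 hx

open Module in
theorem exists_al_generator {R E : Type*} [CommRing R] [IsDedekindDomain R] [AddCommGroup E]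
    [Module R E] [Module.IsTorsionFree R E] {n q q' : Ideal R} (hq : q ≠ ⊥) [Finite (R ⧸ q)]
    (hqq : q * q' = n) (hc : IsCoprime q q') {L L' N : Submodule R E} (hNfg : N.FG)
    (hN : finrank R N = 2) (hL : q • N = L) (hNL : ∀ x, (∀ r ∈ q, r • x ∈ L) → x ∈ N)
    {β : E} (hβ : β ∈ L') (hL' : L' ≤ L ⊔ Submodule.span R {β}) (hn : ∀ r : R, r • β ∈ L ↔ r ∈ n) :
    ∃ x ∈ N ⊔ L', N ⊔ L' ≤ (L ⊔ q' • L') ⊔ Submodule.span R {x} ∧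
      ∀ r : R, r • x ∈ L ⊔ q' • L' ↔ r ∈ n := by
  have : Module.Finite R N := Module.Finite.iff_fg.2 hNfg
  obtain ⟨a, ha, c, hcq, hac⟩ := Ideal.isCoprime_iff_exists.1 hc
  have hnq : n ≤ q := hqq ▸ Ideal.mul_le_left
  have hnq' : n ≤ q' := hqq ▸ Ideal.mul_le_right
  have hv : c • β ∈ N := hNL _ fun r hr => by
    rw [smul_smul, hn, ← hqq]; exact Ideal.mul_mem_mul hr hcq
  have hmap : (q • ⊤ : Submodule R N).map N.subtype = L := by
    rw [Submodule.map_smul'', Submodule.map_subtype_top, hL]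
  have hA : L ⊔ Submodule.span R {c • β} = L ⊔ q' • L' := by
    apply le_antisymm
    · refine sup_le_sup_left ((Submodule.span_singleton_le_iff_mem _ _).2 ?_) _
      exact Submodule.smul_mem_smul hcq hβ
    · refine sup_le le_sup_left (Submodule.smul_le.2 fun s hs y hy => ?_)
      obtain ⟨l, hl, z, hz, rfl⟩ := Submodule.mem_sup.1 (hL' hy)
      obtain ⟨t, rfl⟩ := Submodule.mem_span_singleton.1 hz
      have e : s • (l + t • β) = (s • l + (t * (s * a)) • β) + (t * s) • (c • β) := by
        have : s * t = t * (s * a) + t * s * c := by linear_combination (-(s * t)) * hac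
        rw [smul_add, smul_smul, smul_smul, this, add_smul, add_assoc]
      rw [e]
      refine Submodule.add_mem_sup (L.add_mem (L.smul_mem _ hl) ((hn _).2 ?_))
        (Submodule.smul_mem _ _ (Submodule.mem_span_singleton_self _))
      rw [← hqq, mul_comm s]
      exact Ideal.mul_mem_left _ _ (Ideal.mul_mem_mul ha hs)
  have hmem (x : N) : x ∈ (q • ⊤ : Submodule R N) ⊔ Submodule.span R {⟨c • β, hv⟩} ↔
      (x : E) ∈ L ⊔ q' • L' := by
    rw [← hA, ← hmap, ← Submodule.coe_subtype, ← Submodule.mem_comap]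
    have : Submodule.span R {c • β} =
        (Submodule.span R {(⟨c • β, hv⟩ : N)}).map N.subtype := by
      rw [Submodule.map_span, Set.image_singleton]; rfl
    rw [this, ← Submodule.map_sup, Submodule.comap_map_eq_of_injective N.subtype_injective]
  obtain ⟨g, hg1, hg2⟩ := exists_complement hN hq (v := ⟨c • β, hv⟩) (fun r hr => by
    have h1 : r • (c • β) ∈ L := by
      rw [← hmap]; exact ⟨_, hr, rfl⟩
    rw [smul_smul, hn] at h1
    have : r = r * a + r * c := by rw [← mul_add, hac, mul_one]
    rw [this]
    exact q.add_mem (q.mul_mem_left _ ha) (hnq h1))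
  have hgA (r : R) : r • (g : E) ∈ L ⊔ q' • L' ↔ r ∈ q := by
    rw [← hg2, hmem]; rfl
  have hβA (r : R) : r • β ∈ L ⊔ q' • L' ↔ r ∈ q' := by
    refine ⟨fun h => ?_, fun h => Submodule.mem_sup_right (Submodule.smul_mem_smul h hβ)⟩
    rw [← hA] at h
    obtain ⟨l, hl, z, hz, hlz⟩ := Submodule.mem_sup.1 h
    obtain ⟨t, rfl⟩ := Submodule.mem_span_singleton.1 hz
    have h1 : (r - t * c) • β ∈ L := by
      rw [sub_smul, ← hlz, mul_smul, add_sub_cancel_right]; exact hl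
    have h2 := q'.add_mem (hnq' ((hn _).1 h1)) (q'.mul_mem_left t hcq)
    rwa [sub_add_cancel] at h2
  set A := L ⊔ q' • L' with hAdef
  have hcg : c • (g : E) - g ∈ A := by
    have := A.neg_mem ((hgA a).2 ha)
    rwa [← neg_smul, show -a = c - 1 by linear_combination -hac, sub_smul, one_smul] at this
  have haβ : a • β - β ∈ A := by
    have := A.neg_mem ((hβA c).2 hcq)
    rwa [← neg_smul, show -c = a - 1 by linear_combination -hac, sub_smul, one_smul] at this
  have hgx : (g : E) ∈ A ⊔ Submodule.span R {(g : E) + β} := by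
    have e : (g : E) = (-(c • (g : E) - g) - c • β) + c • ((g : E) + β) := by
      rw [smul_add]; abel
    have h := Submodule.add_mem_sup (A.sub_mem (A.neg_mem hcg) ((hβA c).2 hcq))
      (Submodule.smul_mem _ c (Submodule.mem_span_singleton_self (R := R) ((g : E) + β)))
    rwa [← e] at h
  have hβx : β ∈ A ⊔ Submodule.span R {(g : E) + β} := by
    have e : β = (-(a • β - β) - a • (g : E)) + a • ((g : E) + β) := by
      rw [smul_add]; abel
    have h := Submodule.add_mem_sup (A.sub_mem (A.neg_mem haβ) ((hgA a).2 ha))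
      (Submodule.smul_mem _ a (Submodule.mem_span_singleton_self (R := R) ((g : E) + β)))
    rwa [← e] at h
  refine ⟨g + β, Submodule.add_mem_sup g.2 hβ, sup_le (fun x hx => ?_) (fun x hx => ?_), fun r => ?_⟩
  · obtain ⟨r, hr⟩ := hg1 ⟨x, hx⟩
    rw [hmem] at hr
    have hr' : x - r • (g : E) ∈ A := hr
    rw [← sub_add_cancel x (r • (g : E))]
    exact Submodule.add_mem _ (Submodule.mem_sup_left hr') (Submodule.smul_mem _ _ hgx)
  · obtain ⟨l, hl, z, hz, rfl⟩ := Submodule.mem_sup.1 (hL' hx)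
    obtain ⟨t, rfl⟩ := Submodule.mem_span_singleton.1 hz
    exact Submodule.add_mem _ (Submodule.mem_sup_left (Submodule.mem_sup_left hl))
      (Submodule.smul_mem _ _ hβx)
  · rw [← hqq, Ideal.mul_eq_inf_of_isCoprime hc, Submodule.mem_inf]
    refine ⟨fun h => ⟨(hgA r).1 ?_, (hβA r).1 ?_⟩, fun h => ?_⟩
    · have h1 := A.sub_mem (A.smul_mem c h) (A.smul_mem r (A.add_mem hcg ((hβA c).2 hcq)))
      have e : c • r • ((g : E) + β) - r • (c • (g : E) - g + c • β) = r • (g : E) := by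
        module
      rwa [e] at h1
    · have h1 := A.sub_mem (A.smul_mem a h) (A.smul_mem r (A.add_mem haβ ((hgA a).2 ha)))
      have e : a • r • ((g : E) + β) - r • (a • β - β + a • (g : E)) = r • β := by
        module
      rwa [e] at h1
    · rw [smul_add]
      exact A.add_mem ((hgA r).2 h.1) ((hβA r).2 h.2)


section
variable (K : Type*) [Field K] [NumberField K]

instance : Module.IsTorsionFree (𝓞 K) (RowSpace K) := .trans K

variable {K}

/-- An `𝓞 K`-lattice in `(K ⊗ ℝ)²`: an `𝓞 K`-submodule `L` that spans `(K ⊗ ℝ)²` over `K ⊗ ℝ`,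
lies between two free `𝓞 K`-modules of rank two, is finitely generated, and has a
two-dimensional `K`-span. -/
structure IsLattice (L : Submodule (𝓞 K) (RowSpace K)) : Prop where
  span_eq_top : Submodule.span (KHat K) (L : Set (RowSpace K)) = ⊤
  exists_free : ∃ F₁ F₂ : Submodule (𝓞 K) (RowSpace K),
    Nonempty (Module.Basis (Fin 2) (𝓞 K) F₁) ∧ Nonempty (Module.Basis (Fin 2) (𝓞 K) F₂) ∧
      F₁ ≤ L ∧ L ≤ F₂
  fg : L.FG
  finrank_span : Module.finrank K (Submodule.span K (L : Set (RowSpace K))) = 2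

theorem IsLattice.of_le {L M : Submodule (𝓞 K) (RowSpace K)} (hL : IsLattice L) (hLM : L ≤ M)
    {d : 𝓞 K} (hd : d ≠ 0) (hM : ∀ x ∈ M, d • x ∈ L) : IsLattice M := by
  have hdK : (d : K) ≠ 0 := by simpa using hd
  have hdx (x : RowSpace K) : (d : K)⁻¹ • (d • x) = x := by
    rw [← algebraMap_smul K d x, inv_smul_smul₀ hdK]
  let f : RowSpace K →ₗ[𝓞 K] RowSpace K := (LinearMap.lsmul K (RowSpace K) (d : K)⁻¹).restrictScalars (𝓞 K)
  have hfi : Function.Injective f := smul_right_injective (RowSpace K) (inv_ne_zero hdK)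
  have hMf : M ≤ L.map f := fun x hx => ⟨d • x, hM x hx, hdx x⟩
  refine ⟨?_, ?_, ?_, ?_⟩
  · exact top_le_iff.1 (hL.span_eq_top.symm.le.trans (Submodule.span_mono hLM))
  · obtain ⟨F₁, F₂, h1, ⟨b⟩, hF1, hF2⟩ := hL.exists_free
    exact ⟨F₁, F₂.map f, h1, ⟨b.map (Submodule.equivMapOfInjective f hfi F₂)⟩, hF1.trans hLM,
      hMf.trans (Submodule.map_mono hF2)⟩
  · have := isNoetherian_of_fg_of_noetherian _ (hL.fg.map f)
    exact Submodule.FG.of_le (hL.fg.map f) hMf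
  · have h : Submodule.span K (M : Set (RowSpace K)) = Submodule.span K (L : Set (RowSpace K)) := by
      refine le_antisymm (Submodule.span_le.2 fun x hx => ?_) (Submodule.span_mono hLM)
      rw [SetLike.mem_coe, ← hdx x]
      exact Submodule.smul_mem _ _ (Submodule.subset_span (hM x hx))
    rw [h]; exact hL.finrank_span

theorem IsLattice.finrank_eq {L : Submodule (𝓞 K) (RowSpace K)} (hL : IsLattice L) :
    Module.finrank (𝓞 K) L = 2 := by
  obtain ⟨F₁, F₂, ⟨b₁⟩, ⟨b₂⟩, h1, h2⟩ := hL.exists_free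
  have := Module.Finite.of_basis b₂
  have := Module.Finite.iff_fg.2 hL.fg
  have e1 := Submodule.finrank_mono h1
  have e2 := Submodule.finrank_mono h2
  rw [Module.finrank_eq_card_basis b₁, Fintype.card_fin] at e1
  rw [Module.finrank_eq_card_basis b₂, Fintype.card_fin] at e2
  omega

variable (K) in
/-- A modular point for `Γ₀(n)`: a pair of lattices `L ≤ L'` with `L' / L ≅ 𝓞 K / n`. -/
@[ext] structure ModularPoint (n : Ideal (𝓞 K)) where
  L : Submodule (𝓞 K) (RowSpace K)
  L' : Submodule (𝓞 K) (RowSpace K)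
  isLattice : IsLattice L
  isLattice' : IsLattice L'
  le : L ≤ L'
  quotient_equiv : Nonempty ((L' ⧸ L.submoduleOf L') ≃ₗ[𝓞 K] 𝓞 K ⧸ n)

/-- The modular points `(M, M + L')`, with `M` a superlattice of `L` of index ideal `a`, for a given
modular point `(L, L')`. Each is determined by `M`, and only those `M` occur for which
`(M, M + L')` is a modular point of the same level. -/
def heckeSet {n : Ideal (𝓞 K)} (a : Ideal (𝓞 K)) (P : ModularPoint K n) :
    Set (ModularPoint K n) :=
  {Q | P.L ≤ Q.L ∧ HasIndexIdeal Q.L P.L a ∧ Q.L' = Q.L ⊔ P.L'}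

theorem heckeSet_finite {n : Ideal (𝓞 K)} {a : Ideal (𝓞 K)} (ha : a ≠ ⊥) (P : ModularPoint K n) :
    (heckeSet a P).Finite := by
  have hN : Ideal.absNorm a ≠ 0 := by
    rw [Ne, Ideal.absNorm_eq_zero_iff]; exact ha
  let B : Submodule (𝓞 K) (RowSpace K) :=
    P.L.comap (LinearMap.lsmul (𝓞 K) (RowSpace K) (Ideal.absNorm a : 𝓞 K))
  have hB : IsLattice B :=
    P.isLattice.of_le (fun x hx => P.L.smul_mem _ hx) (Nat.cast_ne_zero.2 hN) fun x hx => hx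
  refine Set.Finite.of_injOn (f := ModularPoint.L) (fun Q hQ => ?_) ?_
    (finite_between (L := P.L) hB.fg hN fun x hx => hx)
  · exact ⟨hQ.1, fun x hx => hQ.2.1.smul_mem (Ideal.absNorm_mem a) hx⟩
  · intro Q hQ Q₂ hQ₂ hL
    have hL' : Q.L' = Q₂.L' := by rw [hQ.2.2, hQ₂.2.2, hL]
    exact ModularPoint.ext hL hL'

/-- The Hecke operator `T_a` on the rational vector space with basis the modular points:
`T_a (L, L') = N(a)⁻¹ ∑ (M, M + L')`, over the superlattices `M` of `L` with `[M : L] = a` for which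
`(M, M + L')` is a modular point. -/
def heckeT (n : Ideal (𝓞 K)) {a : Ideal (𝓞 K)} (ha : a ≠ ⊥) :
    Module.End ℚ (ModularPoint K n →₀ ℚ) :=
  Finsupp.linearCombination ℚ fun P =>
    (Ideal.absNorm a : ℚ)⁻¹ • ∑ Q ∈ (heckeSet_finite ha P).toFinset, Finsupp.single Q 1

/-- The inverse of `q` as a fractional ideal, viewed as an `𝓞 K`-submodule of `K`. Thus
`invIdeal q • L` is the module of finite sums of products `t x` with `t` in `q⁻¹` and `x` in `L`. -/
def invIdeal (q : Ideal (𝓞 K)) : Submodule (𝓞 K) K :=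
  ((q : FractionalIdeal (𝓞 K)⁰ K)⁻¹ : FractionalIdeal (𝓞 K)⁰ K)

theorem mem_inv_smul {q : Ideal (𝓞 K)} (hq : q ≠ ⊥) {M : Submodule (𝓞 K) (RowSpace K)}
    {x : RowSpace K} (hx : ∀ r ∈ q, r • x ∈ M) : x ∈ invIdeal q • M := by
  have h0 : (q : FractionalIdeal (𝓞 K)⁰ K) ≠ 0 := FractionalIdeal.coeIdeal_ne_zero.2 hq
  have h2 : (1 : K) ∈ (q : FractionalIdeal (𝓞 K)⁰ K)⁻¹ * (q : FractionalIdeal (𝓞 K)⁰ K) := by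
    rw [inv_mul_cancel₀ h0]; exact FractionalIdeal.one_mem_one _
  have h3 : ∀ k ∈ (q : FractionalIdeal (𝓞 K)⁰ K)⁻¹ * (q : FractionalIdeal (𝓞 K)⁰ K),
      k • x ∈ invIdeal q • M := by
    intro k hk
    refine FractionalIdeal.mul_induction_on hk (fun i hi j hj => ?_) (fun x y hx hy => ?_)
    · obtain ⟨r, hr, rfl⟩ := (FractionalIdeal.mem_coeIdeal _).1 hj
      rw [mul_smul, algebraMap_smul]
      exact Submodule.smul_mem_smul hi (hx r hr)
    · rw [add_smul]; exact Submodule.add_mem _ hx hy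
  simpa using h3 1 h2

theorem smul_mem_of_mem_inv_smul {q : Ideal (𝓞 K)} (hq : q ≠ ⊥)
    {M : Submodule (𝓞 K) (RowSpace K)} {r : 𝓞 K} (hr : r ∈ q) {x : RowSpace K}
    (hx : x ∈ invIdeal q • M) : r • x ∈ M := by
  have h0 : (q : FractionalIdeal (𝓞 K)⁰ K) ≠ 0 := FractionalIdeal.coeIdeal_ne_zero.2 hq
  refine Submodule.smul_induction_on hx (fun t ht y hy => ?_) (fun y z hy hz => ?_)
  · have h2 : (r : K) * t ∈ (q : FractionalIdeal (𝓞 K)⁰ K) * (q : FractionalIdeal (𝓞 K)⁰ K)⁻¹ :=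
      FractionalIdeal.mul_mem_mul (FractionalIdeal.mem_coeIdeal_of_mem _ hr) ht
    rw [mul_inv_cancel₀ h0, FractionalIdeal.mem_one_iff] at h2
    obtain ⟨c, hc⟩ := h2
    rw [← algebraMap_smul K r, smul_smul, ← hc, algebraMap_smul]
    exact M.smul_mem _ hy
  · rw [smul_add]; exact M.add_mem hy hz

theorem smul_inv_smul {q : Ideal (𝓞 K)} (hq : q ≠ ⊥) (M : Submodule (𝓞 K) (RowSpace K)) :
    q • (invIdeal q • M) = M := by
  refine le_antisymm (Submodule.smul_le.2 fun r hr y hy => smul_mem_of_mem_inv_smul hq hr hy) ?_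
  intro x hx
  have h0 : (q : FractionalIdeal (𝓞 K)⁰ K) ≠ 0 := FractionalIdeal.coeIdeal_ne_zero.2 hq
  have h2 : (1 : K) ∈ (q : FractionalIdeal (𝓞 K)⁰ K) * (q : FractionalIdeal (𝓞 K)⁰ K)⁻¹ := by
    rw [mul_inv_cancel₀ h0]; exact FractionalIdeal.one_mem_one _
  have h3 : ∀ k ∈ (q : FractionalIdeal (𝓞 K)⁰ K) * (q : FractionalIdeal (𝓞 K)⁰ K)⁻¹,
      k • x ∈ q • (invIdeal q • M) := by
    intro k hk
    refine FractionalIdeal.mul_induction_on hk (fun i hi j hj => ?_) (fun x y hx hy => ?_)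
    · obtain ⟨r, hr, rfl⟩ := (FractionalIdeal.mem_coeIdeal _).1 hi
      rw [mul_smul, algebraMap_smul]
      exact Submodule.smul_mem_smul hr (Submodule.smul_mem_smul hj hx)
    · rw [add_smul]; exact Submodule.add_mem _ hx hy
  simpa using h3 1 h2

theorem le_inv_smul {q : Ideal (𝓞 K)} (hq : q ≠ ⊥) (M : Submodule (𝓞 K) (RowSpace K)) :
    M ≤ invIdeal q • M :=
  fun _ hx => mem_inv_smul hq fun r _ => M.smul_mem r hx

theorem ModularPoint.smul_mem {n : Ideal (𝓞 K)} (P : ModularPoint K n) {r : 𝓞 K} (hr : r ∈ n)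
    {x : RowSpace K} (hx : x ∈ P.L') : r • x ∈ P.L := by
  obtain ⟨e⟩ := P.quotient_equiv
  obtain ⟨β, -, hB, hn⟩ := cyc_of_equiv e
  obtain ⟨l, hl, z, hz, rfl⟩ := Submodule.mem_sup.1 (hB hx)
  obtain ⟨t, rfl⟩ := Submodule.mem_span_singleton.1 hz
  rw [smul_add, smul_smul]
  exact P.L.add_mem (P.L.smul_mem _ hl) ((hn _).2 (n.mul_mem_right _ hr))

/-- For `n = q q'` with `q`, `q'` coprime: `(L, L') ↦ (L + q' L', q⁻¹ L + L')`. -/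
def atkinLehnerPoint {n q q' : Ideal (𝓞 K)} (hn : n ≠ ⊥) (hqq : q * q' = n) (hc : IsCoprime q q')
    (P : ModularPoint K n) : ModularPoint K n :=
  have hq : q ≠ ⊥ := by rintro rfl; exact hn (by rw [← hqq, Submodule.bot_mul])
  have hd : ∃ d ∈ n, d ≠ 0 := Submodule.exists_mem_ne_zero_of_ne_bot hn
  have hN : IsLattice (invIdeal q • P.L) := by
    obtain ⟨d, hd, hd0⟩ := Submodule.exists_mem_ne_zero_of_ne_bot hq
    exact P.isLattice.of_le (le_inv_smul hq _) hd0 fun x hx => smul_mem_of_mem_inv_smul hq hd hx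
  { L := P.L ⊔ q' • P.L'
    L' := invIdeal q • P.L ⊔ P.L'
    isLattice := by
      obtain ⟨d, hd, hd0⟩ := hd
      refine P.isLattice.of_le le_sup_left hd0 fun x hx => P.smul_mem hd ?_
      exact sup_le P.le Submodule.smul_le_right hx
    isLattice' := by
      obtain ⟨d, hd, hd0⟩ := hd
      refine P.isLattice.of_le (P.le.trans le_sup_right) hd0 fun x hx => ?_
      obtain ⟨y, hy, z, hz, rfl⟩ := Submodule.mem_sup.1 hx
      rw [smul_add]
      have hdq : d ∈ q := (hqq ▸ Ideal.mul_le_left : n ≤ q) hd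
      exact P.L.add_mem (smul_mem_of_mem_inv_smul hq hdq hy) (P.smul_mem hd hz)
    le := (sup_le P.le Submodule.smul_le_right).trans le_sup_right
    quotient_equiv := by
      obtain ⟨e⟩ := P.quotient_equiv
      obtain ⟨β, hβ, hB, hβn⟩ := cyc_of_equiv e
      have : Finite (𝓞 K ⧸ q) := Ideal.finiteQuotientOfFreeOfNeBot q hq
      obtain ⟨x, hx, hx1, hx2⟩ := exists_al_generator hq hqq hc hN.fg hN.finrank_eq
        (smul_inv_smul hq P.L) (fun x hx => mem_inv_smul hq hx) hβ hB hβn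
      exact equiv_of_cyc hx hx1 hx2 }

/-- The Atkin–Lehner operator `W_q` for `n = q q'` with `q`, `q'` coprime:
`W_q (L, L') = N(q)⁻¹ (L + q' L', q⁻¹ L + L')`, extended linearly. -/
def atkinLehner {n q q' : Ideal (𝓞 K)} (hn : n ≠ ⊥) (hqq : q * q' = n) (hc : IsCoprime q q') :
    Module.End ℚ (ModularPoint K n →₀ ℚ) :=
  Finsupp.linearCombination ℚ fun P =>
    (Ideal.absNorm q : ℚ)⁻¹ • Finsupp.single (atkinLehnerPoint hn hqq hc P) 1

end
end HeckeAL

end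

/-! Fix a point `P = (L, L')`. Both composites send its basis vector to N(a)⁻¹ N(q)⁻¹ times a sum of
points, so it suffices that (M, M + L') ↦ W_q(M, M + L') carries the Hecke set of `P` bijectively
onto the Hecke set of W_q `P`. Everything rests on coprimality: M/L is killed by a and L'/L by n, so
M ∩ L' = L. Hence M also meets L + q'L' exactly in L, and the second isomorphism theorem gives (M +
q'L')/(L + q'L') ≅ M/L: the index ideal is preserved (`atkinLehnerPoint_mem_heckeSet`). The inverse
map takes a superlattice N of L + q'L' of index a to the part of N that a kills modulo L; since an
kills N/L, that part and L + q'L' together make up N (`surjOn_atkinLehnerPoint`). -/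

namespace HeckeAL

/-! ### Coprime annihilators and the second isomorphism theorem -/

section CommRing
variable {R E : Type*} [CommRing R] [AddCommGroup E] [Module R E]

/-- If `a` and `n` are coprime, `a` kills `M` modulo `L` and `n` kills `B` modulo `L`, then
`M ∩ B ⊆ L`. -/
theorem inf_le_of_isCoprime {a n : Ideal R} (h : IsCoprime a n) {L M B : Submodule R E}
    (hM : ∀ r ∈ a, ∀ x ∈ M, r • x ∈ L) (hB : ∀ r ∈ n, ∀ x ∈ B, r • x ∈ L) : M ⊓ B ≤ L := by
  obtain ⟨u, hu, v, hv, huv⟩ := Ideal.isCoprime_iff_exists.1 h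
  rintro x ⟨hxM, hxB⟩
  rw [← one_smul R x, ← huv, add_smul]
  exact L.add_mem (hM u hu x hxM) (hB v hv x hxB)

/-- The second isomorphism theorem, with the intersection and the sum given by name. -/
theorem nonempty_quotient_equiv_of_inf_eq {L M B S : Submodule R E} (hL : M ⊓ B = L)
    (hS : M ⊔ B = S) :
    Nonempty ((M ⧸ L.submoduleOf M) ≃ₗ[R] S ⧸ B.submoduleOf S) := by
  subst hL hS
  exact ⟨LinearMap.quotientInfEquivSupQuotient M B⟩

/-- The index ideal depends only on the isomorphism class of the quotient. With B = L + q'L' it is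
used in one direction to push superlattices of L forward, in the other to pull superlattices of B
back. -/
theorem hasIndexIdeal_iff_of_inf_eq {L M B S : Submodule R E} {a : Ideal R} (hL : M ⊓ B = L)
    (hS : M ⊔ B = S) : HasIndexIdeal S B a ↔ HasIndexIdeal M L a := by
  obtain ⟨f⟩ := nonempty_quotient_equiv_of_inf_eq hL hS
  constructor
  · rintro ⟨a₁, a₂, h, h', ⟨e⟩⟩
    exact ⟨a₁, a₂, h, h', ⟨f.trans e⟩⟩
  · rintro ⟨a₁, a₂, h, h', ⟨e⟩⟩
    exact ⟨a₁, a₂, h, h', ⟨f.symm.trans e⟩⟩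

end CommRing

/-! ### Hecke sets at a level coprime to `a` -/

section NumberField
variable {K : Type*} [Field K] [NumberField K] {n a q q' : Ideal (𝓞 K)}

theorem inf_eq_of_mem_heckeSet (han : IsCoprime a n) {P Q : ModularPoint K n}
    (hQ : Q ∈ heckeSet a P) : Q.L ⊓ P.L' = P.L :=
  le_antisymm
    (inf_le_of_isCoprime han (fun _ hr _ hx => hQ.2.1.smul_mem hr hx)
      fun _ hr _ hx => P.smul_mem hr hx)
    (le_inf hQ.1 P.le)

/-- For `a` coprime to the level, every superlattice `M` of `L` of index ideal `a` gives a point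
of the Hecke set. -/
theorem exists_mem_heckeSet (ha : a ≠ ⊥) (hn : n ≠ ⊥) (han : IsCoprime a n) (P : ModularPoint K n)
    {M : Submodule (𝓞 K) (RowSpace K)} (hLM : P.L ≤ M) (hM : HasIndexIdeal M P.L a) :
    ∃ Q ∈ heckeSet a P, Q.L = M := by
  obtain ⟨d, hd, hd0⟩ := Submodule.exists_mem_ne_zero_of_ne_bot ha
  obtain ⟨c, hc, hc0⟩ := Submodule.exists_mem_ne_zero_of_ne_bot hn
  have hlat : IsLattice M := P.isLattice.of_le hLM hd0 fun x hx => hM.smul_mem hd hx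
  have hlat' : IsLattice (M ⊔ P.L') := hlat.of_le le_sup_left hc0 fun x hx => by
    obtain ⟨y, hy, z, hz, rfl⟩ := Submodule.mem_sup.1 hx
    rw [smul_add]
    exact M.add_mem (M.smul_mem _ hy) (hLM (P.smul_mem hc hz))
  -- From this, (M + L')/M ≅ L'/L ≅ 𝓞 K / n, so the level condition in the Hecke set excludes no M.
  have hinf : P.L' ⊓ M = P.L :=
    le_antisymm
      (inf_le_of_isCoprime han.symm (fun _ hr _ hx => P.smul_mem hr hx)
        fun _ hr _ hx => hM.smul_mem hr hx)
      (le_inf P.le hLM)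
  obtain ⟨f⟩ := nonempty_quotient_equiv_of_inf_eq hinf (sup_comm P.L' M)
  obtain ⟨e⟩ := P.quotient_equiv
  exact ⟨⟨M, M ⊔ P.L', hlat, hlat', le_sup_left, ⟨f.symm.trans e⟩⟩, ⟨hLM, hM, rfl⟩, rfl⟩

theorem eq_of_mem_heckeSet {P Q Q₂ : ModularPoint K n} (hQ : Q ∈ heckeSet a P)
    (hQ₂ : Q₂ ∈ heckeSet a P) (h : Q.L = Q₂.L) : Q = Q₂ :=
  ModularPoint.ext h (by rw [hQ.2.2, hQ₂.2.2, h])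

/-! ### The Atkin–Lehner map as a bijection of Hecke sets -/

theorem sup_smul_le (P : ModularPoint K n) : P.L ⊔ q' • P.L' ≤ P.L' :=
  sup_le P.le Submodule.smul_le_right

/-- As q'M is absorbed by M, the first component is M plus a module q'L' that does not depend on M.
-/
theorem atkinLehnerPoint_L_eq (hn : n ≠ ⊥) (hqq : q * q' = n) (hc : IsCoprime q q')
    {P Q : ModularPoint K n} (hQ : Q ∈ heckeSet a P) :
    (atkinLehnerPoint hn hqq hc Q).L = Q.L ⊔ q' • P.L' := by
  change Q.L ⊔ q' • Q.L' = _
  rw [hQ.2.2, Submodule.smul_sup, ← sup_assoc,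
    sup_eq_left.2 (Submodule.smul_le_right : q' • Q.L ≤ Q.L)]

theorem atkinLehnerPoint_mem_heckeSet (hn : n ≠ ⊥) (han : IsCoprime a n) (hqq : q * q' = n)
    (hc : IsCoprime q q') {P Q : ModularPoint K n} (hQ : Q ∈ heckeSet a P) :
    atkinLehnerPoint hn hqq hc Q ∈ heckeSet a (atkinLehnerPoint hn hqq hc P) := by
  have hq : q ≠ ⊥ := by rintro rfl; exact hn (by rw [← hqq, Submodule.bot_mul])
  have haq : IsCoprime a q := (hqq ▸ han).of_mul_right_left
  have hsup : Q.L ⊔ (P.L ⊔ q' • P.L') = Q.L ⊔ q' • P.L' := by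
    rw [← sup_assoc, sup_eq_left.2 hQ.1]
  have hinf : Q.L ⊓ (P.L ⊔ q' • P.L') = P.L :=
    le_antisymm ((inf_le_inf_left _ (sup_smul_le P)).trans (inf_eq_of_mem_heckeSet han hQ).le)
      (le_inf hQ.1 le_sup_left)
  refine ⟨?_, ?_, ?_⟩
  · rw [atkinLehnerPoint_L_eq hn hqq hc hQ]
    exact sup_le_sup_right hQ.1 _
  · rw [atkinLehnerPoint_L_eq hn hqq hc hQ]
    exact (hasIndexIdeal_iff_of_inf_eq hinf hsup).2 hQ.2.1
  · rw [atkinLehnerPoint_L_eq hn hqq hc hQ]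
    change invIdeal q • Q.L ⊔ Q.L' = (Q.L ⊔ q' • P.L') ⊔ (invIdeal q • P.L ⊔ P.L')
    rw [hQ.2.2]
    apply le_antisymm
    · refine sup_le (fun x hx => ?_) (sup_le ?_ ?_)
      -- The only inclusion with content is q⁻¹M ⊆ M + q⁻¹L. Write x = vx + ux with v in q and u in
      -- a: then vx lies in M, and q(ux) = u(qx) ⊆ uM ⊆ L puts ux in q⁻¹L.
      · obtain ⟨u, hu, v, hv, huv⟩ := Ideal.isCoprime_iff_exists.1 haq
        rw [← one_smul (𝓞 K) x, ← huv, add_comm, add_smul]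
        refine Submodule.add_mem_sup
          (Submodule.mem_sup_left (smul_mem_of_mem_inv_smul hq hv hx))
          (Submodule.mem_sup_left (mem_inv_smul hq fun r hr => ?_))
        rw [smul_comm]
        exact hQ.2.1.smul_mem hu (smul_mem_of_mem_inv_smul hq hr hx)
      · exact le_sup_left.trans le_sup_left
      · exact le_sup_right.trans le_sup_right
    · refine sup_le (sup_le (le_sup_left.trans le_sup_right) ?_) (sup_le ?_ ?_)
      · exact Submodule.smul_le_right.trans (le_sup_right.trans le_sup_right)
      · exact (Submodule.smul_mono le_rfl hQ.1).trans le_sup_left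
      · exact le_sup_right.trans le_sup_right

/-- M can be recovered from M + q'L', being the part that a kills modulo L. One inclusion suffices,
the situation being symmetric in the two points. -/
theorem le_of_atkinLehnerPoint_eq (hn : n ≠ ⊥) (han : IsCoprime a n) (hqq : q * q' = n)
    (hc : IsCoprime q q') {P Q Q₂ : ModularPoint K n} (hQ : Q ∈ heckeSet a P)
    (hQ₂ : Q₂ ∈ heckeSet a P)
    (h : atkinLehnerPoint hn hqq hc Q = atkinLehnerPoint hn hqq hc Q₂) : Q.L ≤ Q₂.L := by
  intro x hx
  have hx₂ : x ∈ Q₂.L ⊔ q' • P.L' := by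
    rw [← atkinLehnerPoint_L_eq hn hqq hc hQ₂, ← h, atkinLehnerPoint_L_eq hn hqq hc hQ]
    exact Submodule.mem_sup_left hx
  obtain ⟨u, hu, v, hv, huv⟩ := Ideal.isCoprime_iff_exists.1 han
  obtain ⟨y, hy, z, hz, rfl⟩ := Submodule.mem_sup.1 hx₂
  -- For x = y + z, the terms ux and vz both fall into L: u in a kills `Q.L` modulo L, and v in n
  -- kills L' modulo L.
  rw [← one_smul (𝓞 K) (y + z), ← huv, add_smul, smul_add v]
  exact Q₂.L.add_mem (hQ₂.1 (hQ.2.1.smul_mem hu hx)) (Q₂.L.add_mem (Q₂.L.smul_mem _ hy)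
    (hQ₂.1 (P.smul_mem hv (Submodule.smul_le_right hz))))

theorem injOn_atkinLehnerPoint (hn : n ≠ ⊥) (han : IsCoprime a n) (hqq : q * q' = n)
    (hc : IsCoprime q q') (P : ModularPoint K n) :
    Set.InjOn (atkinLehnerPoint hn hqq hc) (heckeSet a P) := fun _ hQ _ hQ₂ h =>
  eq_of_mem_heckeSet hQ hQ₂ <| le_antisymm
    (le_of_atkinLehnerPoint_eq hn han hqq hc hQ hQ₂ h)
    (le_of_atkinLehnerPoint_eq hn han hqq hc hQ₂ hQ h.symm)

theorem surjOn_atkinLehnerPoint (hn : n ≠ ⊥) (ha : a ≠ ⊥) (han : IsCoprime a n)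
    (hqq : q * q' = n) (hc : IsCoprime q q') (P : ModularPoint K n) :
    Set.SurjOn (atkinLehnerPoint hn hqq hc) (heckeSet a P)
      (heckeSet a (atkinLehnerPoint hn hqq hc P)) := by
  intro Q hQ
  have hle : P.L ⊔ q' • P.L' ≤ Q.L := hQ.1
  have hidx : HasIndexIdeal Q.L (P.L ⊔ q' • P.L') a := hQ.2.1
  -- The preimage: the elements of `Q.L` whose class modulo L is killed by a.
  let M : Submodule (𝓞 K) (RowSpace K) :=
    Q.L ⊓ ⨅ r ∈ a, P.L.comap (LinearMap.lsmul (𝓞 K) (RowSpace K) r)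
  have hmem (x : RowSpace K) : x ∈ M ↔ x ∈ Q.L ∧ ∀ r ∈ a, r • x ∈ P.L := by
    simp [M, Submodule.mem_iInf]
  have hLM : P.L ≤ M := fun x hx =>
    (hmem x).2 ⟨hle (Submodule.mem_sup_left hx), fun r _ => P.L.smul_mem r hx⟩
  have hinf : M ⊓ (P.L ⊔ q' • P.L') = P.L :=
    le_antisymm
      (inf_le_of_isCoprime han (fun r hr x hx => ((hmem x).1 hx).2 r hr)
        fun r hr x hx => P.smul_mem hr (sup_smul_le P hx))
      (le_inf hLM le_sup_left)
  have hsup : M ⊔ (P.L ⊔ q' • P.L') = Q.L := by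
    refine le_antisymm (sup_le inf_le_left hle) fun x hx => ?_
    -- Here ux lies in L + q'L' because a is the index ideal, and vx lies in M because a(vx) = v(ax)
    -- ⊆ vL' ⊆ L.
    obtain ⟨u, hu, v, hv, huv⟩ := Ideal.isCoprime_iff_exists.1 han
    rw [← one_smul (𝓞 K) x, ← huv, add_comm, add_smul]
    refine Submodule.add_mem_sup ((hmem _).2 ⟨Q.L.smul_mem _ hx, fun r hr => ?_⟩)
      (hidx.smul_mem hu hx)
    rw [smul_comm]
    exact P.smul_mem hv (sup_smul_le P (hidx.smul_mem hr hx))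
  obtain ⟨Q₀, hQ₀, hQ₀M⟩ := exists_mem_heckeSet ha hn han P hLM
    ((hasIndexIdeal_iff_of_inf_eq hinf hsup).1 hidx)
  -- Both points lie in the same Hecke set, so agreement of the first components is enough.
  refine ⟨Q₀, hQ₀, eq_of_mem_heckeSet (atkinLehnerPoint_mem_heckeSet hn han hqq hc hQ₀) hQ ?_⟩
  rw [atkinLehnerPoint_L_eq hn hqq hc hQ₀, hQ₀M, ← hsup, ← sup_assoc, sup_eq_left.2 hLM]

theorem bijOn_atkinLehnerPoint (hn : n ≠ ⊥) (ha : a ≠ ⊥) (han : IsCoprime a n)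
    (hqq : q * q' = n) (hc : IsCoprime q q') (P : ModularPoint K n) :
    Set.BijOn (atkinLehnerPoint hn hqq hc) (heckeSet a P)
      (heckeSet a (atkinLehnerPoint hn hqq hc P)) :=
  ⟨fun _ hQ => atkinLehnerPoint_mem_heckeSet hn han hqq hc hQ,
    injOn_atkinLehnerPoint hn han hqq hc P, surjOn_atkinLehnerPoint hn ha han hqq hc P⟩

/-! ### The operators on basis vectors -/

theorem heckeT_single (ha : a ≠ ⊥) (P : ModularPoint K n) :
    heckeT n ha (Finsupp.single P 1) =
      (Ideal.absNorm a : ℚ)⁻¹ • ∑ Q ∈ (heckeSet_finite ha P).toFinset, Finsupp.single Q 1 := by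
  rw [heckeT, Finsupp.linearCombination_single, one_smul]

theorem atkinLehner_single (hn : n ≠ ⊥) (hqq : q * q' = n) (hc : IsCoprime q q')
    (P : ModularPoint K n) :
    atkinLehner hn hqq hc (Finsupp.single P 1) =
      (Ideal.absNorm q : ℚ)⁻¹ • Finsupp.single (atkinLehnerPoint hn hqq hc P) 1 := by
  rw [atkinLehner, Finsupp.linearCombination_single, one_smul]

end NumberField
end HeckeAL

theorem mainTheorem5 (K : Type*) [Field K] [NumberField K]
    (n : Ideal (𝓞 K)) (hn : n ≠ ⊥)
    (a : Ideal (𝓞 K)) (ha : a ≠ ⊥) (han : IsCoprime a n)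
    (q q' : Ideal (𝓞 K)) (hqq : q * q' = n) (hc : IsCoprime q q') :
    Commute (HeckeAL.heckeT n ha) (HeckeAL.atkinLehner hn hqq hc) := by
  refine Finsupp.lhom_ext' fun P => LinearMap.ext_ring ?_
  change HeckeAL.heckeT n ha (HeckeAL.atkinLehner hn hqq hc (Finsupp.single P 1)) =
    HeckeAL.atkinLehner hn hqq hc (HeckeAL.heckeT n ha (Finsupp.single P 1))
  have hbij := HeckeAL.bijOn_atkinLehnerPoint hn ha han hqq hc P
  rw [HeckeAL.atkinLehner_single, map_smul, HeckeAL.heckeT_single, HeckeAL.heckeT_single, map_smul,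
    map_sum, smul_comm]
  simp_rw [HeckeAL.atkinLehner_single]
  rw [← Finset.smul_sum]
  -- The scalars now agree on both sides; what remains is to reindex the sum along the bijection
  -- `hbij`.
  congr 2
  symm
  refine Finset.sum_bij (fun Q _ => HeckeAL.atkinLehnerPoint hn hqq hc Q) (fun Q hQ => ?_)
    (fun Q hQ Q₂ hQ₂ h => ?_) (fun Q hQ => ?_) (fun _ _ => rfl)
  · rw [Set.Finite.mem_toFinset] at hQ ⊢
    exact hbij.mapsTo hQ
  · rw [Set.Finite.mem_toFinset] at hQ hQ₂
    exact hbij.injOn hQ hQ₂ h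
  · rw [Set.Finite.mem_toFinset] at hQ
    obtain ⟨Q₀, hQ₀, h⟩ := hbij.surjOn hQ
    exact ⟨Q₀, (Set.Finite.mem_toFinset _).2 hQ₀, h⟩
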